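/- Consider $N$ agents in $\mathbb{R}^d$ with single-integrator dynamics $\dot{\boldsymbol x}_i=\boldsymbol u_i$, $i=1,\dots,N$, and let $\boldsymbol x=[\boldsymbol x_1^\top,\dots,\boldsymbol x_N^\top]^\top\in\mathbb{R}^{Nd}$. Agent $i$ has finitely many long-term spatial constraints $\psi_{i,k}>0$, $k=1,\dots,m_i$, where each $\psi_{i,k}$ is a continuously differentiable real function of $\boldsymbol x_i$ and of the positions of a (possibly empty) set of other agents, which may differ from constraint to constraint; $\psi_{i,k}(\boldsymbol x)$ denotes its value at the corresponding blocks of $\boldsymbol x$. The task dependency graph on the set of agents has an edge $(i,j)$, $i\ne j$, if some constraint function of agent $i$ depends on $\boldsymbol x_j$ (self-edges play no role below); a maximal dependency cluster is a connected component of this graph when edge directions are ignored. Agents communicate over an undirected graph $\mathcal G^c$, and $\mathcal N^c_i$ is the set of neighbours of $i$. For $\nu_\alpha,\nu_\beta>0$ put $$h_i(\boldsymbol x)=\sum_{k=1}^{m_i}e^{-\nu_\alpha\psi_{i,k}(\boldsymbol x)},\quad f_i=h_i^{\nu_\beta/\nu_\alpha},\quad f=\sum_{i=1}^N f_i,\quad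 \alpha_i=-\tfrac1{\nu_\alpha}\ln h_i,\quad \beta=-\tfrac1{\nu_\beta}\ln\Big(\sum_{i=1}^N e^{-\nu_\beta\alpha_i}\Big).$$ Assume: (1) the communication subgraph on every maximal dependency cluster is connected; (2) there is exactly one maximal dependency cluster (the set of all agents); (3) along every trajectory in $\mathbb{R}^{Nd}$ on which $\|\boldsymbol x\|\to\infty$, at least one constraint function goes to $-\infty$, in the sense that $\min_{i,k}\psi_{i,k}\to-\infty$; (4) every $\psi_{i,k}$ is concave in its arguments, and for every agent $i$ at least one $\psi_{i,k}$ is strictly concave in its arguments (jointly, $\boldsymbol x_i$ being one of them). Then $f$ has a unique minimizer $\hat{\boldsymbol x}^*\in\mathbb{R}^{Nd}$, which is also the unique maximizer of $\beta$. Moreover, let $k_1,k_2>0$ and consider the protocol in which every agent $i$ keeps an estimate $\hat{\boldsymbol x}^i\in\mathbb{R}^{Nd}$ of $\boldsymbol x$ and an integral state $\boldsymbol z_i\in\mathbb{R}^{Nd}$ with $$\dot{\hat{\boldsymbol x}}^i=-k_1\nabla f_i(\hat{\boldsymbol x}^i)-k_2\sum_{j\in\mathcal N^c_i}(\hat{\boldsymbol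 x}^i-\hat{\boldsymbol x}^j)-\boldsymbol z_i,\qquad \dot{\boldsymbol z}_i=k_1k_2\sum_{j\in\mathcal N^c_i}(\hat{\boldsymbol x}^i-\hat{\boldsymbol x}^j),$$ and applies the control $\boldsymbol u_i$ equal to the $i$-th block of $\dot{\hat{\boldsymbol x}}^i$. For all initial positions $\boldsymbol x(0)$ and all initial estimates $\hat{\boldsymbol x}^i(0)$ whose $i$-th block is $\boldsymbol x_i(0)$, with $\boldsymbol z_i(0)=\boldsymbol 0$ for all $i$, the closed loop has a solution on $[0,\infty)$, and every such solution satisfies $\boldsymbol x(t)\to\hat{\boldsymbol x}^*$ as $t\to\infty$. -/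

import Mathlib

open Filter Topology

noncomputable section

/-- Stacked vectors consisting of one point of `ℝ^d` for every element of `ι`: the Euclidean space
with coordinates indexed by pairs of an element of `ι` and a spatial direction. -/
abbrev Config (ι : Type) (d : ℕ) : Type := EuclideanSpace ℝ (ι × Fin d)

/-- The block of the stacked vector `x` that belongs to `i`. -/
def Config.block {ι : Type} {d : ℕ} (x : Config ι d) (i : ι) : EuclideanSpace ℝ (Fin d) :=
  WithLp.toLp 2 (fun c => x (i, c))

/-- The constraint functions `ψ i k`, `k = 1, …, m i`, of the agents `i = 1, …, N` in `ℝ^d`.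
The function `ψ i k` takes as arguments the positions of the agents in `args i k`, one of which
is agent `i` itself (different constraints of one agent may involve different agents). -/
structure ConstraintSystem (N d : ℕ) where
  m : Fin N → ℕ
  args : (i : Fin N) → Fin (m i) → Finset (Fin N)
  self_mem_args : ∀ i k, i ∈ args i k
  ψ : (i : Fin N) → (k : Fin (m i)) → Config {j // j ∈ args i k} d → ℝ

namespace ConstraintSystem

variable {N d : ℕ} (S : ConstraintSystem N d)

/-- The value of the `k`-th constraint function of agent `i` at the stacked position vector `x`. -/
def val (i : Fin N) (k : Fin (S.m i)) (x : Config (Fin N) d) : ℝ :=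
  S.ψ i k (WithLp.toLp 2 (fun p => x (p.1.1, p.2)))

/-- All constraint functions are continuously differentiable. -/
def IsC1 : Prop := ∀ i k, ContDiff ℝ 1 (S.ψ i k)

/-! ### Task dependency graph -/

/-- The `k`-th constraint function of agent `i` depends on the position of agent `j`. -/
def DependsOnAgent (i : Fin N) (k : Fin (S.m i)) (j : Fin N) : Prop :=
  ∃ x y : Config (Fin N) d, (∀ l, l ≠ j → Config.block x l = Config.block y l) ∧ S.val i k x ≠ S.val i k y

/-- Directed edges of the task dependency graph: `(i, j)`, `i ≠ j`, is an edge if some constraint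
of agent `i` depends on the position of agent `j`; `(i, i)` is an edge if some constraint of
agent `i` depends on the position of agent `i` only. -/
def TaskEdge (i j : Fin N) : Prop :=
  ∃ k, S.DependsOnAgent i k j ∧ (i = j → ∀ l, l ≠ i → ¬ S.DependsOnAgent i k l)

/-- There is a (possibly trivial) path between `i` and `j` along edges of the task dependency
graph, their directions being ignored. -/
def TaskConnected (i j : Fin N) : Prop := Relation.EqvGen S.TaskEdge i j

/-- Maximal dependency clusters. -/
structure IsMaximalCluster (C : Set (Fin N)) : Prop where
  nonempty : C.Nonempty
  connected : ∀ i ∈ C, ∀ j ∈ C, S.TaskConnected i j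
  separated : ∀ i ∈ C, ∀ q ∉ C, ¬ S.TaskConnected i q

/-- The communication subgraph on every maximal dependency cluster is connected. -/
def CommConnectedOnClusters (G : SimpleGraph (Fin N)) : Prop :=
  ∀ C : Set (Fin N), S.IsMaximalCluster C → (G.induce C).Connected

/-- The task dependency graph consists of a single maximal dependency cluster. -/
def HasOneCluster : Prop := S.IsMaximalCluster Set.univ

/-! ### Coercivity and concavity -/

/-- Along every trajectory on which `‖x‖ → ∞`, at least one of the constraint functions goes to
`-∞`; which one it is may change with time, so that it is the minimum of all the constraint
functions that tends to `-∞`. -/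
def Coercive : Prop :=
  ∀ γ : ℝ → Config (Fin N) d, Tendsto (fun t => ‖γ t‖) atTop atTop →
    ∀ M : ℝ, ∀ᶠ t in atTop, ∃ i k, S.val i k (γ t) < M

/-- All constraint functions are concave in their arguments. -/
def IsConcave : Prop := ∀ i k, ConcaveOn ℝ Set.univ (S.ψ i k)

/-- Every agent has a constraint function that is strictly concave in its arguments. -/
def HasStrictlyConcave : Prop := ∀ i, ∃ k, StrictConcaveOn ℝ Set.univ (S.ψ i k)

/-! ### Objective functions -/

/-- `h i x = ∑ k, exp (-να * ψ i k x)`. -/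
def h (να : ℝ) (i : Fin N) (x : Config (Fin N) d) : ℝ :=
  ∑ k, Real.exp (-να * S.val i k x)

/-- The smooth under-approximation of `min_k ψ i k`. -/
def α (να : ℝ) (i : Fin N) (x : Config (Fin N) d) : ℝ :=
  -(1 / να) * Real.log (∑ k, Real.exp (-να * S.val i k x))

/-- The smooth under-approximation of `min_i min_k ψ i k`. -/
def β (να νβ : ℝ) (x : Config (Fin N) d) : ℝ :=
  -(1 / νβ) * Real.log (∑ i, Real.exp (-νβ * S.α να i x))

/-- The local objective function of agent `i`. -/
def localCost (να νβ : ℝ) (i : Fin N) (x : Config (Fin N) d) : ℝ :=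
  S.h να i x ^ (νβ / να)

/-- The global objective function. -/
def cost (να νβ : ℝ) (x : Config (Fin N) d) : ℝ :=
  ∑ i, S.localCost να νβ i x

/-! ### The protocol -/

/-- The rate of change of agent `i`'s estimate of the stacked position vector, when the estimates
are `e` and the integral states are `z`. -/
def estimateRate (G : SimpleGraph (Fin N)) [DecidableRel G.Adj] (να νβ k₁ k₂ : ℝ)
    (e z : Fin N → Config (Fin N) d) (i : Fin N) : Config (Fin N) d :=
  -(k₁ • gradient (S.localCost να νβ i) (e i))
    - k₂ • (∑ j ∈ G.neighborFinset i, (e i - e j)) - z i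

/-- `x`, `e`, `z` is a trajectory on `[0, ∞)` of the closed loop: the `i`-th block of `x t` is
the position of agent `i`, `e t i` its estimate of all positions, `z t i` its integral state. -/
structure IsClosedLoop (G : SimpleGraph (Fin N)) [DecidableRel G.Adj] (να νβ k₁ k₂ : ℝ)
    (x : ℝ → Config (Fin N) d) (e z : ℝ → Fin N → Config (Fin N) d) : Prop where
  /-- Estimate dynamics. -/
  estimate : ∀ t, 0 ≤ t → ∀ i, HasDerivWithinAt (fun s => e s i)
    (S.estimateRate G να νβ k₁ k₂ (e t) (z t) i) (Set.Ici 0) t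
  /-- Integral dynamics. -/
  integral : ∀ t, 0 ≤ t → ∀ i, HasDerivWithinAt (fun s => z s i)
    ((k₁ * k₂) • ∑ j ∈ G.neighborFinset i, (e t i - e t j)) (Set.Ici 0) t
  /-- Single integrator whose input is the `i`-th block of the derivative of `e · i`. -/
  position : ∀ t, 0 ≤ t → ∀ i, HasDerivWithinAt (fun s => Config.block (x s) i)
    (Config.block (derivWithin (fun s => e s i) (Set.Ici 0) t) i) (Set.Ici 0) t
  /-- Each agent's initial estimate of its own position is correct. -/
  init_estimate : ∀ i, Config.block (e 0 i) i = Config.block (x 0) i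
  /-- The integral states start at zero. -/
  init_integral : ∀ i, z 0 i = 0

end ConstraintSystem

end

/-! Cost. Concavity of the constraints and Hölder's inequality make each `h i` log-convex, so its
positive powers are convex. Agent `i`'s strictly concave constraint involves its own block, so local
cost `i` is strictly convex between points that differ in block `i`; hence `cost` is strictly
convex. It dominates every `exp (-νβ * ψ)`, so coercivity bounds its sublevel sets and a unique
minimizer exists. Finally `β` is a decreasing function of `cost`.

Dynamics. As `z` starts at zero, it is `c` times the net outflow of edge variables that integrate
`c` times the disagreement along directed edges, with `2 * c ^ 2 = k₁ * k₂`. In node and edge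
variables the coupling is skew, so the field is continuous and dissipative for the Euclidean inner
product (`inner_primalDualField_sub`). Gradients are only continuous, so Picard-Lindelöf does not
apply directly; dissipativity replaces the Lipschitz condition in `exists_solution_of_dissipative`.

Convergence. At the minimizer the local gradients sum to zero, so on a connected graph some edge
flow balances them: this is an equilibrium. The squared distance to it is a Lyapunov function.
Vanishing dissipation forces consensus, and then convexity forces the common value to be the
minimizer (`tendsto_of_dissipation`, `tendsto_of_primalDual`). -/

/-! ### Global solutions of dissipative differential equations -/

section DissipativeODE

open Set Metric MeasureTheory
open scoped InnerProductSpace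

variable {Y : Type*} [NormedAddCommGroup Y] [InnerProductSpace ℝ Y]

/-- A curve that starts at the origin and whose radial speed is at most `c` as long as it stays in
a ball does not leave that ball before it could have been reached at speed `c + δ`. -/
theorem norm_le_of_inner_deriv_le_of_mem_ball {y y' : ℝ → Y} {T c δ R : ℝ}
    (hc : 0 ≤ c) (hδ : 0 < δ) (hR : (c + δ) * T + δ ≤ R) (h0 : y 0 = 0)
    (hy : ∀ t ∈ Icc 0 T, HasDerivAt y (y' t) t)
    (hle : ∀ t ∈ Icc 0 T, ‖y t‖ ≤ R → ⟪y t, y' t⟫_ℝ ≤ c * ‖y t‖) :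
    ∀ t ∈ Icc 0 T, ‖y t‖ ≤ (c + δ) * t + δ := by
  have key : ∀ ⦃t⦄, t ∈ Icc 0 T → ‖y t‖ ^ 2 ≤ ((c + δ) * t + δ) ^ 2 := by
    -- Derivatives are compared only at contact with the barrier `(c + δ) * t + δ`. There the norm
    -- is positive, so the inequality is strict, and at most `R`, so `hle` applies.
    refine image_le_of_deriv_right_lt_deriv_boundary (f' := fun t => 2 * ⟪y t, y' t⟫_ℝ)
      (B' := fun t => 2 * ((c + δ) * t + δ) * (c + δ)) ?_ ?_ ?_ ?_ ?_
    · intro t ht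
      exact ((hy t ht).continuousAt.norm.pow 2).continuousWithinAt
    · intro t ht
      exact (hy t ⟨ht.1, ht.2.le⟩).hasDerivWithinAt.norm_sq
    · rw [h0, norm_zero, zero_pow two_ne_zero]; exact sq_nonneg _
    · intro t
      have := ((((hasDerivAt_id t).const_mul (c + δ)).add_const δ).pow 2)
      simp only [id, mul_one, Nat.cast_ofNat, Nat.add_one_sub_one, pow_one] at this
      exact this
    · intro t ht heq
      have hB : 0 < (c + δ) * t + δ := by
        have := mul_nonneg (add_nonneg hc hδ.le) ht.1
        linarith
      have hn : ‖y t‖ = (c + δ) * t + δ := (sq_eq_sq₀ (norm_nonneg _) hB.le).1 heq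
      have hRt : ‖y t‖ ≤ R := by
        rw [hn]
        have := mul_le_mul_of_nonneg_left ht.2.le (add_nonneg hc hδ.le)
        linarith
      have h1 := hle t ⟨ht.1, ht.2.le⟩ hRt
      rw [hn] at h1
      nlinarith [mul_pos hδ hB]
  intro t ht
  have hB : 0 ≤ (c + δ) * t + δ := by
    have := mul_nonneg (add_nonneg hc hδ.le) ht.1
    linarith
  exact (sq_le_sq₀ (norm_nonneg _) hB).1 (key ht)

/-- The limit `δ → 0` of the previous bound, with no ball to respect. -/
theorem norm_le_of_inner_deriv_le {y y' : ℝ → Y} {T c : ℝ} (hc : 0 ≤ c) (h0 : y 0 = 0)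
    (hy : ∀ t ∈ Icc 0 T, HasDerivAt y (y' t) t)
    (hle : ∀ t ∈ Icc 0 T, ⟪y t, y' t⟫_ℝ ≤ c * ‖y t‖) :
    ∀ t ∈ Icc 0 T, ‖y t‖ ≤ c * t := by
  intro t ht
  have h : ∀ δ : ℝ, 0 < δ → ‖y t‖ ≤ (c + δ) * t + δ := fun δ hδ =>
    norm_le_of_inner_deriv_le_of_mem_ball hc hδ le_rfl h0 hy (fun s hs _ => hle s hs) t ht
  refine le_of_forall_pos_le_add fun η hη => ?_
  have h1 : 0 < t + 1 := by linarith [ht.1]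
  have := h (η / (t + 1)) (by positivity)
  calc ‖y t‖ ≤ _ := this
    _ = c * t + η := by field_simp; ring

/-- A Lipschitz vector field with bounded values has solutions on every bounded interval. -/
theorem exists_solution_of_lipschitz_of_bounded [CompleteSpace Y] {g : Y → Y} {K : NNReal} {C : ℝ}
    (hg : LipschitzWith K g) (hC : ∀ x, ‖g x‖ ≤ C) (T : ℝ) (hT : 0 ≤ T) (y₀ : Y) :
    ∃ y : ℝ → Y, y 0 = y₀ ∧ ∀ t ∈ Icc 0 T, HasDerivAt y (g (y t)) t := by
  have hC0 : 0 ≤ C := (norm_nonneg _).trans (hC y₀)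
  -- The time interval exceeds `[0, T]` on both sides to get two-sided derivatives at its ends; at
  -- speed `C` no solution leaves the ball of radius `C * (T + 1)` in that time.
  have hpl : IsPicardLindelof (fun _ : ℝ => g) (tmin := -1) (tmax := T + 1)
      ⟨0, by constructor <;> linarith⟩ y₀ (.mk (C * (T + 1)) (by positivity)) 0 (.mk C hC0) K := by
    refine .of_time_independent (fun x _ => hC x) hg.lipschitzOnWith ?_
    have : max (T + 1 - 0) (0 - (-1)) = T + 1 := by
      rw [max_eq_left (by linarith), sub_zero]
    rw [this]
    simp
  obtain ⟨y, hy0, hy⟩ := hpl.exists_eq_forall_mem_Icc_hasDerivWithinAt₀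
  exact ⟨y, hy0, fun t ht => (hy t ⟨by linarith [ht.1], by linarith [ht.2]⟩).hasDerivAt
    (Icc_mem_nhds (by linarith [ht.1]) (by linarith [ht.2]))⟩

/-- Cut `F` off by a bump function, then smooth it: a `C¹` function with compact support is
Lipschitz and bounded. -/
theorem exists_lipschitz_approx_on_closedBall [FiniteDimensional ℝ Y] {F : Y → Y}
    (hF : Continuous F) (y₀ : Y) {R ε : ℝ} (hR : 0 < R) (hε : 0 < ε) :
    ∃ (g : Y → Y) (K : NNReal) (C : ℝ), LipschitzWith K g ∧ (∀ x, ‖g x‖ ≤ C) ∧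
      ∀ x ∈ closedBall y₀ R, ‖g x - F x‖ ≤ ε := by
  let χ : ContDiffBump y₀ := ⟨R, R + 1, hR, by linarith⟩
  have hcont : Continuous fun x => χ x • F x := χ.continuous.smul hF
  obtain ⟨g, hgs, hgd, hgsupp⟩ := hcont.exists_contDiff_approx 1 (ε := fun _ => ε)
    continuous_const (fun _ => hε)
  have hcs : HasCompactSupport g := by
    refine (χ.hasCompactSupport.smul_right (f' := F)).mono ?_
    exact hgsupp
  obtain ⟨K, hK⟩ := hgs.lipschitzWith_of_hasCompactSupport hcs (by simp)
  obtain ⟨C, hC⟩ := hcs.exists_bound_of_continuous hgs.continuous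
  refine ⟨g, K, C, hK, hC, fun x hx => ?_⟩
  have := hgd x
  rw [χ.one_of_mem_closedBall hx, one_smul, dist_eq_norm] at this
  exact this.le

/-- Approximate solutions, on bounded intervals, of an equation with dissipative right side. -/
theorem exists_approx_solution [FiniteDimensional ℝ Y] {F : Y → Y} (hF : Continuous F)
    (hdiss : ∀ x y, ⟪x - y, F x - F y⟫_ℝ ≤ 0) (y₀ : Y) {T ε : ℝ} (hT : 0 ≤ T) (hε : 0 < ε) :
    ∃ y v : ℝ → Y, y 0 = y₀ ∧ (∀ t ∈ Icc 0 T, HasDerivAt y (v t) t) ∧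
      ∀ t ∈ Icc 0 T, ‖v t - F (y t)‖ ≤ ε := by
  set c := ‖F y₀‖ + ε with hc
  have hc0 : 0 ≤ c := by positivity
  -- The radius is the barrier for `δ = 1` at time `T`, so the solution stays where `g` is close to
  -- `F`.
  obtain ⟨g, K, C, hK, hC, hg⟩ := exists_lipschitz_approx_on_closedBall hF y₀
    (R := (c + 1) * T + 1) (by positivity) hε
  obtain ⟨y, hy0, hy⟩ := exists_solution_of_lipschitz_of_bounded hK hC T hT y₀
  have hb := norm_le_of_inner_deriv_le_of_mem_ball (y := fun t => y t - y₀)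
    (y' := fun t => g (y t)) hc0 one_pos le_rfl (by simp [hy0])
    (fun t ht => (hy t ht).sub_const y₀) (by
      intro t ht hR
      have h1 := hg (y t) (by rwa [mem_closedBall, dist_eq_norm])
      have h2 := hdiss (y t) y₀
      calc ⟪y t - y₀, g (y t)⟫_ℝ
          = ⟪y t - y₀, F (y t) - F y₀⟫_ℝ + ⟪y t - y₀, (g (y t) - F (y t)) + F y₀⟫_ℝ := by
            rw [← inner_add_right]; congr 1; abel
        _ ≤ 0 + ‖y t - y₀‖ * (‖g (y t) - F (y t)‖ + ‖F y₀‖) := by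
            gcongr
            exact (real_inner_le_norm _ _).trans (by gcongr; exact norm_add_le _ _)
        _ ≤ ‖y t - y₀‖ * (ε + ‖F y₀‖) := by rw [zero_add]; gcongr
        _ = c * ‖y t - y₀‖ := by rw [hc]; ring)
  refine ⟨y, fun t => g (y t), hy0, hy, fun t ht => hg _ ?_⟩
  rw [mem_closedBall, dist_eq_norm]
  refine (hb t ht).trans ?_
  have := mul_le_mul_of_nonneg_left ht.2 (add_nonneg hc0 zero_le_one)
  linarith

/-- By dissipativity the `F` terms cannot drive the curves apart; only the residuals can, so the gap
grows linearly, without Grönwall's exponential. -/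
theorem norm_sub_le_of_approx_solution {F : Y → Y} (hdiss : ∀ x y, ⟪x - y, F x - F y⟫_ℝ ≤ 0)
    {y v w u : ℝ → Y} {T ε η : ℝ} (hε : 0 ≤ ε) (hη : 0 ≤ η) (h0 : y 0 = w 0)
    (hy : ∀ t ∈ Icc 0 T, HasDerivAt y (v t) t) (hv : ∀ t ∈ Icc 0 T, ‖v t - F (y t)‖ ≤ ε)
    (hw : ∀ t ∈ Icc 0 T, HasDerivAt w (u t) t) (hu : ∀ t ∈ Icc 0 T, ‖u t - F (w t)‖ ≤ η) :
    ∀ t ∈ Icc 0 T, ‖y t - w t‖ ≤ (ε + η) * t := by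
  refine norm_le_of_inner_deriv_le (y := fun t => y t - w t) (y' := fun t => v t - u t)
    (add_nonneg hε hη) (by simp [h0]) (fun t ht => (hy t ht).sub (hw t ht)) fun t ht => ?_
  calc ⟪y t - w t, v t - u t⟫_ℝ
      = ⟪y t - w t, F (y t) - F (w t)⟫_ℝ
        + ⟪y t - w t, (v t - F (y t)) - (u t - F (w t))⟫_ℝ := by
        rw [← inner_add_right]; congr 1; abel
    _ ≤ 0 + ‖y t - w t‖ * (‖v t - F (y t)‖ + ‖u t - F (w t)‖) := by
        gcongr
        · exact hdiss _ _
        · exact (real_inner_le_norm _ _).trans (by gcongr; exact norm_sub_le _ _)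
    _ ≤ ‖y t - w t‖ * (ε + η) := by rw [zero_add]; gcongr; exacts [hv t ht, hu t ht]
    _ = (ε + η) * ‖y t - w t‖ := by ring

/-- An autonomous differential equation with continuous dissipative right side has a solution on
`[0, ∞)` for every initial value. -/
theorem exists_solution_of_dissipative [FiniteDimensional ℝ Y] {F : Y → Y} (hF : Continuous F)
    (hdiss : ∀ x y, ⟪x - y, F x - F y⟫_ℝ ≤ 0) (y₀ : Y) :
    ∃ y : ℝ → Y, y 0 = y₀ ∧ ∀ t, 0 ≤ t → HasDerivWithinAt y (F (y t)) (Ici 0) t := by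
  have hε : ∀ n : ℕ, (0 : ℝ) < 1 / (n + 1) := fun n => by positivity
  choose y v hy0 hy hv using fun n : ℕ =>
    exists_approx_solution hF hdiss y₀ (T := n) (Nat.cast_nonneg n) (hε n)
  have hε0 : Tendsto (fun n : ℕ => (1 : ℝ) / (n + 1)) atTop (𝓝 0) :=
    tendsto_one_div_add_atTop_nhds_zero_nat
  have hsub : ∀ {n m : ℕ}, n ≤ m → ∀ t ∈ Icc (0 : ℝ) n, t ∈ Icc (0 : ℝ) m := fun h t ht =>
    ⟨ht.1, ht.2.trans (by exact_mod_cast h)⟩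
  have hdist : ∀ n m : ℕ, n ≤ m → ∀ t ∈ Icc (0 : ℝ) n,
      ‖y n t - y m t‖ ≤ 2 * (1 / (n + 1)) * t := by
    intro n m hnm t ht
    have h := norm_sub_le_of_approx_solution hdiss (hε n).le (hε m).le
      ((hy0 n).trans (hy0 m).symm) (hy n) (hv n)
      (fun s hs => hy m s (hsub hnm s hs)) (fun s hs => hv m s (hsub hnm s hs)) t ht
    have hle : (1 : ℝ) / (m + 1) ≤ 1 / (n + 1) := by
      have : (n : ℝ) ≤ m := by exact_mod_cast hnm
      gcongr
    refine h.trans ?_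
    have := ht.1
    gcongr
    linarith
  have hlim : ∀ t : ℝ, ∃ l : Y, 0 ≤ t → Tendsto (fun n => y n t) atTop (𝓝 l) := by
    intro t
    by_cases ht : 0 ≤ t
    · have hcau : CauchySeq fun n => y n t := by
        rw [Metric.cauchySeq_iff']
        intro η hη
        have h0 : Tendsto (fun n : ℕ => 2 * ((1 : ℝ) / (n + 1)) * t) atTop (𝓝 0) := by
          simpa using (hε0.const_mul 2).mul_const t
        obtain ⟨n, hn, hnt⟩ := ((h0.eventually (gt_mem_nhds hη)).and
          (tendsto_natCast_atTop_atTop.eventually_ge_atTop t)).exists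
        refine ⟨n, fun m hm => ?_⟩
        rw [dist_comm, dist_eq_norm]
        exact (hdist n m hm t ⟨ht, hnt⟩).trans_lt hn
      obtain ⟨l, hl⟩ := cauchySeq_tendsto_of_complete hcau
      exact ⟨l, fun _ => hl⟩
    · exact ⟨0, fun h => absurd h ht⟩
  choose x hx using hlim
  have hclose : ∀ n : ℕ, ∀ t ∈ Icc (0 : ℝ) n, ‖y n t - x t‖ ≤ 2 * (1 / (n + 1)) * t := by
    intro n t ht
    refine le_of_tendsto ((tendsto_const_nhds.sub (hx t ht.1)).norm) ?_
    filter_upwards [eventually_ge_atTop n] with m hm using hdist n m hm t ht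
  have hxIcc : ∀ T : ℝ, 0 ≤ T → ContinuousOn x (Icc 0 T) := by
    intro T hT
    have hu : TendstoUniformlyOn y x atTop (Icc 0 T) := by
      rw [Metric.tendstoUniformlyOn_iff]
      intro η hη
      have h0 : Tendsto (fun n : ℕ => 2 * ((1 : ℝ) / (n + 1)) * T) atTop (𝓝 0) := by
        simpa using (hε0.const_mul 2).mul_const T
      filter_upwards [h0.eventually (gt_mem_nhds hη),
        tendsto_natCast_atTop_atTop.eventually_ge_atTop T] with n hn hnT t ht
      rw [dist_comm, dist_eq_norm]
      refine (hclose n t ⟨ht.1, ht.2.trans hnT⟩).trans_lt (lt_of_le_of_lt ?_ hn)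
      have := (hε n).le
      gcongr
      exact ht.2
    refine hu.continuousOn (Eventually.frequently ?_)
    filter_upwards [tendsto_natCast_atTop_atTop.eventually_ge_atTop T] with n hnT t ht
    exact (hy n t ⟨ht.1, ht.2.trans hnT⟩).continuousAt.continuousWithinAt
  have hxIci : ContinuousOn x (Ici 0) := by
    intro t ht
    refine (hxIcc (t + 1) (by linarith [mem_Ici.1 ht]) t ⟨ht, by linarith⟩).mono_of_mem_nhdsWithin ?_
    exact mem_nhdsWithin.2 ⟨Iio (t + 1), isOpen_Iio, by simp, fun s hs => ⟨hs.2, hs.1.le⟩⟩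
  have hxc : Continuous fun s => x (max s 0) :=
    hxIci.comp_continuous (by fun_prop) fun s => mem_Ici.2 (le_max_right s 0)
  have hint : ∀ t, 0 ≤ t → x t = y₀ + ∫ s in (0 : ℝ)..t, F (x (max s 0)) := by
    intro t ht
    -- Clamping time to `[0, t]` makes the integrands continuous on the whole line, although `y n`
    -- is controlled only on `[0, n]`.
    let p : ℝ → ℝ := fun s => max 0 (min s t)
    have hpm : ∀ s, p s ∈ Icc 0 t := fun s => ⟨le_max_left _ _, max_le ht (min_le_right _ _)⟩
    have hpe : ∀ s ∈ Icc 0 t, p s = s := fun s hs => by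
      simp only [p]; rw [min_eq_left hs.2, max_eq_right hs.1]
    have hpc : Continuous p := by fun_prop
    have hwc : ∀ n : ℕ, t ≤ n → Continuous fun s => F (y n (p s)) := fun n hn =>
      hF.comp (ContinuousOn.comp_continuous (s := Icc 0 t)
        (fun s hs => (hy n s ⟨hs.1, hs.2.trans hn⟩).continuousAt.continuousWithinAt) hpc hpm)
    have hres : ∀ n : ℕ, t ≤ n →
        ‖(y n t - ∫ s in (0 : ℝ)..t, F (y n (p s))) - y₀‖ ≤ 1 / (n + 1) * t := by
      intro n hn
      have := norm_image_sub_le_of_norm_deriv_le_segment' (a := 0) (b := t) (C := 1 / (n + 1))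
        (f := fun r => y n r - ∫ s in (0 : ℝ)..r, F (y n (p s)))
        (f' := fun r => v n r - F (y n (p r)))
        (fun r hr => (((hy n r ⟨hr.1, hr.2.trans hn⟩).sub
          ((hwc n hn).integral_hasStrictDerivAt 0 r).hasDerivAt)).hasDerivWithinAt)
        (fun r hr => by
          rw [hpe r ⟨hr.1, hr.2.le⟩]
          exact hv n r ⟨hr.1, hr.2.le.trans hn⟩) t ⟨ht, le_rfl⟩
      simpa [hy0] using this
    have hI : Tendsto (fun n => ∫ s in (0 : ℝ)..t, F (y n (p s))) atTop
        (𝓝 (∫ s in (0 : ℝ)..t, F (x (max s 0)))) := by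
      -- Dominating constant: `x` is bounded by `M` on `[0, t]` and `y n` is within `2 * t` of it,
      -- so `F` is bounded on the ball of radius `M + 2 * t`.
      obtain ⟨M, hM⟩ := isCompact_Icc.exists_bound_of_continuousOn (hxIcc t ht)
      obtain ⟨C, hC⟩ := (isCompact_closedBall (0 : Y) (M + 2 * t)).exists_bound_of_continuousOn
        hF.continuousOn
      have hev : ∀ᶠ n : ℕ in atTop, t ≤ n :=
        tendsto_natCast_atTop_atTop.eventually_ge_atTop t
      refine intervalIntegral.tendsto_integral_filter_of_dominated_convergence (fun _ => C)
        ?_ ?_ (by simp) ?_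
      · filter_upwards [hev] with n hn using (hwc n hn).aestronglyMeasurable
      · filter_upwards [hev] with n hn
        refine Eventually.of_forall fun s _ => hC _ ?_
        have h1 := hclose n (p s) ⟨(hpm s).1, (hpm s).2.trans hn⟩
        have h2 := hM (p s) (hpm s)
        have h3 : 2 * ((1 : ℝ) / (n + 1)) * p s ≤ 2 * 1 * t := by
          have h4 : (1 : ℝ) / (n + 1) ≤ 1 := by
            rw [div_le_one (by positivity)]; linarith [(Nat.cast_nonneg n : (0 : ℝ) ≤ n)]
          have := (hpm s).1
          gcongr
          exact (hpm s).2
        rw [mem_closedBall_zero_iff]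
        calc ‖y n (p s)‖ = ‖x (p s) + (y n (p s) - x (p s))‖ := by congr 1; abel
          _ ≤ ‖x (p s)‖ + ‖y n (p s) - x (p s)‖ := norm_add_le _ _
          _ ≤ M + 2 * t := by linarith
      · refine Eventually.of_forall fun s hs => ?_
        rw [uIoc_of_le ht] at hs
        rw [hpe s ⟨hs.1.le, hs.2⟩, max_eq_left hs.1.le]
        exact (hF.tendsto _).comp (hx s hs.1.le)
    have h1 : Tendsto (fun n => (y n t - ∫ s in (0 : ℝ)..t, F (y n (p s))) - y₀) atTop (𝓝 0) := by
      refine squeeze_zero_norm' ?_ (by simpa using hε0.mul_const t)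
      filter_upwards [tendsto_natCast_atTop_atTop.eventually_ge_atTop t] with n hn
      exact (hres n hn).trans_eq (by rw [one_div])
    have h2 := tendsto_nhds_unique h1 (((hx t ht).sub hI).sub_const y₀)
    rw [sub_sub, eq_comm, sub_eq_zero] at h2
    rw [h2, add_comm]
  refine ⟨x, tendsto_nhds_unique (hx 0 le_rfl) (by simp [hy0]), fun t ht => ?_⟩
  have hd := ((((hF.comp hxc).integral_hasStrictDerivAt 0 t).hasDerivAt).const_add
    y₀).hasDerivWithinAt (s := Ici 0)
  simp only [Function.comp_apply, max_eq_left ht] at hd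
  exact hd.congr (fun s hs => hint s hs) (hint t ht)

end DissipativeODE

/-! ### Convergence from a Lyapunov function -/

section LyapunovConvergence

open Set Metric
open scoped InnerProductSpace

variable {Y : Type*} [NormedAddCommGroup Y] [InnerProductSpace ℝ Y]

/-- The distance to an equilibrium of a dissipative equation does not increase; it decreases at
least at the speed of a lower bound for the dissipation. -/
theorem norm_sub_sq_add_le_of_inner_le {F : Y → Y} {y : ℝ → Y} {yeq : Y} {a b c : ℝ}
    (hab : a ≤ b) (ha : 0 ≤ a)
    (hy : ∀ t, 0 ≤ t → HasDerivWithinAt y (F (y t)) (Ici 0) t)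
    (hc : ∀ t ∈ Icc a b, ⟪y t - yeq, F (y t)⟫_ℝ ≤ -c) :
    ‖y b - yeq‖ ^ 2 + 2 * c * (b - a) ≤ ‖y a - yeq‖ ^ 2 := by
  have h := image_le_of_deriv_right_le_deriv_boundary (a := a) (b := b)
    (f := fun t => ‖y t - yeq‖ ^ 2) (f' := fun t => 2 * ⟪y t - yeq, F (y t)⟫_ℝ)
    (B := fun t => ‖y a - yeq‖ ^ 2 - 2 * c * (t - a)) (B' := fun _ => - (2 * c))
    (fun t ht => ((((hy t (ha.trans ht.1)).sub_const yeq).norm_sq).mono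
      fun s hs => ha.trans hs.1).continuousWithinAt)
    (fun t ht => (((hy t (ha.trans ht.1)).sub_const yeq).norm_sq).mono
      (Ici_subset_Ici.2 (ha.trans ht.1)))
    (by simp) (by fun_prop)
    (fun t _ => by
      have := (((hasDerivAt_id t).sub_const a).const_mul (2 * c)).const_sub (‖y a - yeq‖ ^ 2)
      simpa using this.hasDerivWithinAt)
    (fun t ht => by linarith [hc t ⟨ht.1, ht.2.le⟩]) ⟨hab, le_rfl⟩
  linarith

/-- Convergence by a LaSalle type argument: if the squared distance to `yeq` is a Lyapunov function
whose dissipation vanishes only where `q` takes the value `qeq`, then `q` tends to `qeq` along every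
trajectory. -/
theorem tendsto_of_dissipation [FiniteDimensional ℝ Y] {Q : Type*} [TopologicalSpace Q]
    {F : Y → Y} (hF : Continuous F) {q : Y → Q} (hq : Continuous q) {yeq : Y} {qeq : Q}
    (hle : ∀ x, ⟪x - yeq, F x⟫_ℝ ≤ 0) (heq : ∀ x, ⟪x - yeq, F x⟫_ℝ = 0 → q x = qeq)
    {y : ℝ → Y} (hy : ∀ t, 0 ≤ t → HasDerivWithinAt y (F (y t)) (Ici 0) t) :
    Tendsto (fun t => q (y t)) atTop (𝓝 qeq) := by
  set W : Y → ℝ := fun x => ⟪x - yeq, F x⟫_ℝ with hW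
  have hWc : Continuous W := (continuous_id.sub continuous_const).inner hF
  set K := closedBall yeq ‖y 0 - yeq‖ with hK
  have hKc : IsCompact K := isCompact_closedBall _ _
  have hmono : ∀ a b, 0 ≤ a → a ≤ b → ‖y b - yeq‖ ^ 2 ≤ ‖y a - yeq‖ ^ 2 := fun a b ha hab => by
    simpa using norm_sub_sq_add_le_of_inner_le (c := 0) hab ha hy fun t _ => by simpa using hle _
  have hyK : ∀ t, 0 ≤ t → y t ∈ K := fun t ht => by
    rw [hK, mem_closedBall, dist_eq_norm]
    exact (sq_le_sq₀ (norm_nonneg _) (norm_nonneg _)).1 (hmono 0 t le_rfl ht)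
  obtain ⟨C, hC⟩ := hKc.exists_bound_of_continuousOn hF.continuousOn
  have hlip : ∀ a b, 0 ≤ a → a ≤ b → ‖y b - y a‖ ≤ C * (b - a) := fun a b ha hab =>
    norm_image_sub_le_of_norm_deriv_le_segment' (f' := fun t => F (y t))
      (fun t ht => (hy t (ha.trans ht.1)).mono fun s hs => ha.trans hs.1)
      (fun t ht => hC _ (hyK t (ha.trans ht.1))) b ⟨hab, le_rfl⟩
  have hC0 : 0 ≤ C := (norm_nonneg _).trans (hC _ (hyK 0 le_rfl))
  have hVlim : ∃ l, Tendsto (fun t => ‖y (max t 0) - yeq‖ ^ 2) atTop (𝓝 l) := by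
    refine ⟨_, tendsto_atTop_ciInf (fun a b hab => hmono _ _ (le_max_right _ _)
      (max_le_max_right 0 hab)) ⟨0, ?_⟩⟩
    rintro _ ⟨t, rfl⟩
    positivity
  obtain ⟨l, hl⟩ := hVlim
  -- If `W (y t) ≤ -ε`, then `W ≤ -ε / 2` along the curve for a fixed time `τ`, since the speed is
  -- at most `C`. The squared distance then drops by `ε * τ`, which its convergence excludes for
  -- late `t`.
  have hW0 : Tendsto (fun t => W (y t)) atTop (𝓝 0) := by
    rw [Metric.tendsto_atTop']
    intro ε hε
    obtain ⟨δ, hδ, hδW⟩ := Metric.uniformContinuousOn_iff.1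
      (hKc.uniformContinuousOn_of_continuous hWc.continuousOn) (ε / 2) (half_pos hε)
    set τ := δ / (2 * (C + 1)) with hτ
    have hτ0 : 0 < τ := by positivity
    have hCτ : C * τ < δ := by
      have h : (C + 1) * τ = δ / 2 := by rw [hτ]; field_simp
      nlinarith
    have hdiff : Tendsto (fun t => ‖y (max t 0) - yeq‖ ^ 2 - ‖y (max (t + τ) 0) - yeq‖ ^ 2)
        atTop (𝓝 0) := by
      simpa using hl.sub (hl.comp (tendsto_atTop_add_const_right _ τ tendsto_id))
    obtain ⟨T, hT⟩ := eventually_atTop.1 (hdiff.eventually (gt_mem_nhds (mul_pos hε hτ0)))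
    refine ⟨max T 0, fun t ht => ?_⟩
    have ht0 : 0 ≤ t := (le_max_right _ _).trans ht.le
    have hTt := hT t ((le_max_left _ _).trans ht.le)
    rw [max_eq_left ht0, max_eq_left (by linarith)] at hTt
    rw [Real.dist_0_eq_abs, abs_of_nonpos (hle _)]
    by_contra! hcon
    have := norm_sub_sq_add_le_of_inner_le (c := ε / 2) (a := t) (b := t + τ) (yeq := yeq)
      (by linarith) ht0 hy fun s hs => by
        have hs0 : 0 ≤ s := ht0.trans hs.1
        have h1 := hδW (y s) (hyK s hs0) (y t) (hyK t ht0) (by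
          rw [dist_eq_norm]
          refine (hlip t s ht0 hs.1).trans_lt (lt_of_le_of_lt ?_ hCτ)
          gcongr
          linarith [hs.2])
        rw [Real.dist_eq, abs_lt] at h1
        have h2 : W (y s) < W (y t) + ε / 2 := by linarith [h1.2]
        change W (y s) ≤ _
        linarith
    have h3 : 2 * (ε / 2) * (t + τ - t) = ε * τ := by ring
    linarith
  rw [_root_.tendsto_nhds]
  intro U hU hqU
  by_contra hnot
  -- On the compact part of `K` outside `q ⁻¹' U` the maximum of `W` is negative, so `W (y t) → 0`
  -- rules out late returns there.
  have hclosed : IsCompact (K ∩ (q ⁻¹' U)ᶜ) :=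
    hKc.inter_right (hU.preimage hq).isClosed_compl
  obtain ⟨t₀, ht₀, ht₀U⟩ := (((not_eventually.1 hnot).and_eventually (eventually_ge_atTop 0))).exists
  obtain ⟨m, hm, hmax⟩ := hclosed.exists_isMaxOn ⟨y t₀, hyK _ ht₀U, ht₀⟩ hWc.continuousOn
  have hmneg : W m < 0 := lt_of_le_of_ne (hle m) fun h => hm.2 (by
    change q m ∈ U
    rwa [heq m h])
  obtain ⟨t, ht, htW, ht0⟩ := ((not_eventually.1 hnot).and_eventually
    ((hW0.eventually (lt_mem_nhds hmneg)).and (eventually_ge_atTop 0))).exists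
  exact absurd (hmax ⟨hyK t ht0, ht⟩) (not_le.2 htW)

end LyapunovConvergence

/-! ### Hölder and gradient inequalities -/

section Convexity

open scoped InnerProductSpace

/-- Hölder's inequality for sums of exponentials. -/
theorem sum_exp_le_rpow_mul_rpow {ι : Type*} (s : Finset ι) (u v : ι → ℝ) {a b : ℝ} (ha : 0 < a)
    (hb : 0 < b) (hab : a + b = 1) :
    ∑ k ∈ s, Real.exp (a * u k + b * v k) ≤
      (∑ k ∈ s, Real.exp (u k)) ^ a * (∑ k ∈ s, Real.exp (v k)) ^ b := by
  have h := Real.inner_le_Lp_mul_Lq_of_nonneg s (p := 1 / a) (q := 1 / b)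
    (f := fun k => Real.exp (a * u k)) (g := fun k => Real.exp (b * v k))
    (by rw [Real.holderConjugate_iff_eq_conjExponent (by rw [lt_div_iff₀ ha]; linarith)]
        have : 1 / a - 1 = b / a := by field_simp; linarith
        rw [this]; field_simp)
    (fun _ _ => (Real.exp_pos _).le) (fun _ _ => (Real.exp_pos _).le)
  simp only [one_div, inv_inv, ← Real.exp_mul, ← Real.exp_add] at h
  have hu : ∀ k, a * u k * a⁻¹ = u k := fun k => by field_simp
  have hv : ∀ k, b * v k * b⁻¹ = v k := fun k => by field_simp
  simpa only [hu, hv] using h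

/-- Weighted AM-GM for `X ^ p` and `Y ^ p`; it turns log-convexity into convexity of powers. -/
theorem rpow_mul_rpow_rpow_le {X Y a b p : ℝ} (hX : 0 ≤ X) (hY : 0 ≤ Y) (ha : 0 ≤ a) (hb : 0 ≤ b)
    (hab : a + b = 1) : (X ^ a * Y ^ b) ^ p ≤ a * X ^ p + b * Y ^ p := by
  rw [Real.mul_rpow (by positivity) (by positivity), ← Real.rpow_mul hX, ← Real.rpow_mul hY,
    mul_comm a, mul_comm b, Real.rpow_mul hX, Real.rpow_mul hY]
  exact Real.geom_mean_le_arith_mean2_weighted ha hb (by positivity) (by positivity) hab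

/-- The gradient inequality for convex functions. -/
theorem ConvexOn.add_inner_gradient_le {E : Type*} [NormedAddCommGroup E] [InnerProductSpace ℝ E]
    [CompleteSpace E] {f : E → ℝ} (hf : ConvexOn ℝ Set.univ f) {x : E}
    (hd : DifferentiableAt ℝ f x) (y : E) : f x + ⟪gradient f x, y - x⟫_ℝ ≤ f y := by
  have hg : ConvexOn ℝ Set.univ (f ∘ AffineMap.lineMap (k := ℝ) x y) := by
    simpa using hf.comp_affineMap (AffineMap.lineMap (k := ℝ) x y)
  have hder : HasDerivAt (f ∘ AffineMap.lineMap (k := ℝ) x y) (fderiv ℝ f x (y - x)) 0 := by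
    refine HasFDerivAt.comp_hasDerivAt (0 : ℝ) ?_ AffineMap.hasDerivAt_lineMap
    simpa using hd.hasFDerivAt
  have := hg.le_slope_of_hasDerivAt (Set.mem_univ 0) (Set.mem_univ 1) one_pos hder
  rw [slope_def_field] at this
  simp only [Function.comp_apply, AffineMap.lineMap_apply_one, AffineMap.lineMap_apply_zero,
    sub_zero, div_one] at this
  rw [inner_gradient_left]
  linarith

theorem ConvexOn.inner_gradient_sub_gradient_nonneg {E : Type*} [NormedAddCommGroup E]
    [InnerProductSpace ℝ E] [CompleteSpace E] {f : E → ℝ} (hf : ConvexOn ℝ Set.univ f)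
    (hd : Differentiable ℝ f) (x y : E) :
    0 ≤ ⟪x - y, gradient f x - gradient f y⟫_ℝ := by
  have h1 := hf.add_inner_gradient_le (hd x) y
  have h2 := hf.add_inner_gradient_le (hd y) x
  rw [← neg_sub x y, inner_neg_right, real_inner_comm] at h1
  rw [real_inner_comm] at h2
  rw [inner_sub_right]
  linarith

theorem ContDiff.continuous_gradient {E : Type*} [NormedAddCommGroup E] [InnerProductSpace ℝ E]
    [CompleteSpace E] {f : E → ℝ} (hf : ContDiff ℝ 1 f) : Continuous (gradient f) :=
  (InnerProductSpace.toDual ℝ E).symm.continuous.comp (hf.continuous_fderiv (by simp))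

end Convexity

/-! ### Strict convexity, coercivity and the minimizer of the cost -/

namespace ConstraintSystem

variable {N d : ℕ} {S : ConstraintSystem N d} {να νβ : ℝ}

theorem HasStrictlyConcave.nonempty (h : S.HasStrictlyConcave) (i : Fin N) :
    Nonempty (Fin (S.m i)) := ⟨(h i).choose⟩

theorem HasStrictlyConcave.h_pos (h : S.HasStrictlyConcave) (i : Fin N) (x : Config (Fin N) d) :
    0 < S.h να i x := by
  have := h.nonempty i
  exact Finset.sum_pos (fun _ _ => Real.exp_pos _) Finset.univ_nonempty

theorem IsC1.contDiff_val (hC1 : S.IsC1) (i : Fin N) (k : Fin (S.m i)) :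
    ContDiff ℝ 1 (S.val i k) :=
  (hC1 i k).comp (contDiff_euclidean.2 fun p => contDiff_euclidean.1 contDiff_id (p.1.1, p.2))

theorem IsC1.contDiff_localCost (hC1 : S.IsC1) (hstrict : S.HasStrictlyConcave) (i : Fin N) :
    ContDiff ℝ 1 (S.localCost να νβ i) := by
  refine ContDiff.rpow_const_of_ne ?_ fun x => (hstrict.h_pos i x).ne'
  exact ContDiff.sum fun k _ => (contDiff_const.mul (hC1.contDiff_val i k)).exp

theorem IsConcave.le_val (hconc : S.IsConcave) (i : Fin N) (k : Fin (S.m i))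
    (x y : Config (Fin N) d) {a b : ℝ} (ha : 0 ≤ a) (hb : 0 ≤ b) (hab : a + b = 1) :
    a * S.val i k x + b * S.val i k y ≤ S.val i k (a • x + b • y) :=
  (hconc i k).2 (Set.mem_univ _) (Set.mem_univ _) ha hb hab

/-- Strict concavity helps only if the arguments of the constraint differ; block `i` is always among
them. -/
theorem HasStrictlyConcave.exists_lt_val (hstrict : S.HasStrictlyConcave) {i : Fin N}
    {x y : Config (Fin N) d} (hxy : ∃ c, x (i, c) ≠ y (i, c)) {a b : ℝ} (ha : 0 < a) (hb : 0 < b)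
    (hab : a + b = 1) :
    ∃ k, a * S.val i k x + b * S.val i k y < S.val i k (a • x + b • y) := by
  obtain ⟨k, hk⟩ := hstrict i
  obtain ⟨c, hc⟩ := hxy
  refine ⟨k, hk.2 (Set.mem_univ _) (Set.mem_univ _) (fun h => hc ?_) ha hb hab⟩
  exact congrArg (fun z : Config {j // j ∈ S.args i k} d => z (⟨i, S.self_mem_args i k⟩, c)) h

theorem h_combo_le (hconc : S.IsConcave) (hνα : 0 < να) (i : Fin N)
    (x y : Config (Fin N) d) {a b : ℝ} (ha : 0 < a) (hb : 0 < b) (hab : a + b = 1) :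
    S.h να i (a • x + b • y) ≤ S.h να i x ^ a * S.h να i y ^ b := by
  refine le_trans (Finset.sum_le_sum fun k _ => Real.exp_le_exp.2 ?_)
    (sum_exp_le_rpow_mul_rpow Finset.univ (fun k => -να * S.val i k x)
      (fun k => -να * S.val i k y) ha hb hab)
  nlinarith [mul_le_mul_of_nonneg_left (hconc.le_val i k x y ha.le hb.le hab) hνα.le]

theorem h_combo_lt (hconc : S.IsConcave) (hstrict : S.HasStrictlyConcave) (hνα : 0 < να)
    {i : Fin N} {x y : Config (Fin N) d} (hxy : ∃ c, x (i, c) ≠ y (i, c)) {a b : ℝ} (ha : 0 < a)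
    (hb : 0 < b) (hab : a + b = 1) :
    S.h να i (a • x + b • y) < S.h να i x ^ a * S.h να i y ^ b := by
  obtain ⟨k₀, hk₀⟩ := hstrict.exists_lt_val hxy ha hb hab
  refine lt_of_lt_of_le (Finset.sum_lt_sum (fun k _ => Real.exp_le_exp.2 ?_)
    ⟨k₀, Finset.mem_univ _, Real.exp_lt_exp.2 ?_⟩)
    (sum_exp_le_rpow_mul_rpow Finset.univ (fun k => -να * S.val i k x)
      (fun k => -να * S.val i k y) ha hb hab)
  · nlinarith [mul_le_mul_of_nonneg_left (hconc.le_val i k x y ha.le hb.le hab) hνα.le]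
  · nlinarith [mul_lt_mul_of_pos_left hk₀ hνα]

theorem convexOn_localCost (hconc : S.IsConcave) (hstrict : S.HasStrictlyConcave) (hνα : 0 < να)
    (hνβ : 0 < νβ) (i : Fin N) : ConvexOn ℝ Set.univ (S.localCost να νβ i) := by
  refine convexOn_iff_forall_pos.2 ⟨convex_univ, fun x _ y _ a b ha hb hab => ?_⟩
  refine le_trans (Real.rpow_le_rpow (hstrict.h_pos i _).le
    (h_combo_le hconc hνα i x y ha hb hab) (by positivity)) ?_
  exact rpow_mul_rpow_rpow_le (hstrict.h_pos i _).le (hstrict.h_pos i _).le ha.le hb.le hab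

theorem localCost_combo_lt (hconc : S.IsConcave) (hstrict : S.HasStrictlyConcave) (hνα : 0 < να)
    (hνβ : 0 < νβ) {i : Fin N} {x y : Config (Fin N) d} (hxy : ∃ c, x (i, c) ≠ y (i, c)) {a b : ℝ}
    (ha : 0 < a) (hb : 0 < b) (hab : a + b = 1) :
    S.localCost να νβ i (a • x + b • y)
      < a * S.localCost να νβ i x + b * S.localCost να νβ i y := by
  refine lt_of_lt_of_le (Real.rpow_lt_rpow (hstrict.h_pos i _).le
    (h_combo_lt hconc hstrict hνα hxy ha hb hab) (by positivity)) ?_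
  exact rpow_mul_rpow_rpow_le (hstrict.h_pos i _).le (hstrict.h_pos i _).le ha.le hb.le hab

theorem strictConvexOn_cost (hconc : S.IsConcave) (hstrict : S.HasStrictlyConcave) (hνα : 0 < να)
    (hνβ : 0 < νβ) : StrictConvexOn ℝ Set.univ (S.cost να νβ) := by
  refine ⟨convex_univ, fun x _ y _ hxy a b ha hb hab => ?_⟩
  have hex : ∃ p, x p ≠ y p := by
    by_contra! h
    exact hxy (PiLp.ext h)
  -- The agent in whose block the points differ supplies the strict inequality; the other terms are
  -- convex.
  obtain ⟨⟨i, c⟩, hp⟩ := hex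
  simp only [cost, smul_eq_mul, Finset.mul_sum, ← Finset.sum_add_distrib]
  exact Finset.sum_lt_sum (fun j _ => (convexOn_localCost hconc hstrict hνα hνβ j).2
    (Set.mem_univ _) (Set.mem_univ _) ha.le hb.le hab)
    ⟨i, Finset.mem_univ _, localCost_combo_lt hconc hstrict hνα hνβ ⟨c, hp⟩ ha hb hab⟩

theorem IsC1.contDiff_cost (hC1 : S.IsC1) (hstrict : S.HasStrictlyConcave) :
    ContDiff ℝ 1 (S.cost να νβ) :=
  ContDiff.sum fun i _ => hC1.contDiff_localCost hstrict i

theorem localCost_pos (hstrict : S.HasStrictlyConcave) (i : Fin N) (x : Config (Fin N) d) :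
    0 < S.localCost να νβ i x :=
  Real.rpow_pos_of_pos (hstrict.h_pos i x) _

theorem exp_le_cost (hstrict : S.HasStrictlyConcave) (hνα : 0 < να) (hνβ : 0 < νβ) (i : Fin N)
    (k : Fin (S.m i)) (x : Config (Fin N) d) :
    Real.exp (-νβ * S.val i k x) ≤ S.cost να νβ x := by
  have h1 : Real.exp (-να * S.val i k x) ≤ S.h να i x :=
    Finset.single_le_sum (f := fun k => Real.exp (-να * S.val i k x))
      (fun _ _ => (Real.exp_pos _).le) (Finset.mem_univ k)
  calc Real.exp (-νβ * S.val i k x) = Real.exp (-να * S.val i k x) ^ (νβ / να) := by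
        rw [← Real.exp_mul]; congr 1; field_simp
    _ ≤ S.localCost να νβ i x := Real.rpow_le_rpow (Real.exp_pos _).le h1 (by positivity)
    _ ≤ S.cost να νβ x := Finset.single_le_sum (f := fun i => S.localCost να νβ i x)
        (fun j _ => (localCost_pos hstrict j x).le) (Finset.mem_univ i)

/-- Otherwise a point of norm at least `R` violating the claim, chosen for each `R`, gives a curve
contradicting coercivity; curves need not be continuous there. -/
theorem Coercive.exists_radius (hcoer : S.Coercive) (M : ℝ) :
    ∃ R : ℝ, ∀ x : Config (Fin N) d, R ≤ ‖x‖ → ∃ i k, S.val i k x < M := by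
  by_contra! hcon
  choose γ hγ hval using hcon
  obtain ⟨t, i, k, hlt⟩ := (hcoer γ (tendsto_atTop_mono hγ tendsto_id) M).exists
  exact absurd hlt (not_lt.2 (hval t i k))

theorem isBounded_cost_le (hcoer : S.Coercive) (hstrict : S.HasStrictlyConcave) (hνα : 0 < να)
    (hνβ : 0 < νβ) (c : ℝ) : Bornology.IsBounded {x | S.cost να νβ x ≤ c} := by
  -- Below this threshold `-νβ * ψ > c`, and `exp u ≥ u + 1` pushes the cost above `c`.
  obtain ⟨R, hR⟩ := hcoer.exists_radius (-c / νβ)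
  refine (Metric.isBounded_closedBall (x := (0 : Config (Fin N) d)) (r := R)).subset fun x hx => ?_
  rw [mem_closedBall_zero_iff]
  by_contra! hlt
  obtain ⟨i, k, hik⟩ := hR x hlt.le
  rw [lt_div_iff₀ hνβ] at hik
  have h1 := Real.add_one_le_exp (-νβ * S.val i k x)
  have h2 := exp_le_cost hstrict hνα hνβ i k x
  have h3 : S.cost να νβ x ≤ c := hx
  linarith

theorem exists_minimizers_cost_eq_singleton (hC1 : S.IsC1) (hcoer : S.Coercive)
    (hconc : S.IsConcave) (hstrict : S.HasStrictlyConcave) (hνα : 0 < να) (hνβ : 0 < νβ) :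
    ∃ xhat, {x | IsMinOn (S.cost να νβ) Set.univ x} = {xhat} := by
  obtain ⟨xhat, hmin⟩ := (hC1.contDiff_cost hstrict).continuous.exists_forall_le_of_isBounded 0
    (isBounded_cost_le hcoer hstrict hνα hνβ _)
  have hxhat : IsMinOn (S.cost να νβ) Set.univ xhat := fun y _ => hmin y
  refine ⟨xhat, Set.eq_singleton_iff_unique_mem.2 ⟨hxhat, fun x hx => ?_⟩⟩
  exact (strictConvexOn_cost hconc hstrict hνα hνβ).eq_of_isMinOn hx hxhat
    (Set.mem_univ _) (Set.mem_univ _)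

theorem β_eq_log_cost (hstrict : S.HasStrictlyConcave) (x : Config (Fin N) d) :
    S.β να νβ x = -(1 / νβ) * Real.log (S.cost να νβ x) := by
  have : ∀ i, Real.exp (-νβ * S.α να i x) = S.localCost να νβ i x := fun i => by
    rw [localCost, Real.rpow_def_of_pos (hstrict.h_pos i x)]
    congr 1
    simp only [α, h]
    ring
  simp only [β, this, cost]

theorem isMaxOn_β_iff [NeZero N] (hstrict : S.HasStrictlyConcave) (hνβ : 0 < νβ)
    (x : Config (Fin N) d) :
    IsMaxOn (S.β να νβ) Set.univ x ↔ IsMinOn (S.cost να νβ) Set.univ x := by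
  have hpos : ∀ y, 0 < S.cost να νβ y := fun y =>
    Finset.sum_pos (fun i _ => localCost_pos hstrict i y) Finset.univ_nonempty
  have hc : 0 < 1 / νβ := by positivity
  refine forall₂_congr fun y _ => ?_
  change S.β να νβ y ≤ S.β να νβ x ↔ S.cost να νβ x ≤ S.cost να νβ y
  rw [β_eq_log_cost hstrict, β_eq_log_cost hstrict, neg_mul, neg_mul, neg_le_neg_iff,
    mul_le_mul_iff_right₀ hc, Real.log_le_log_iff (hpos x) (hpos y)]

theorem sum_gradient_localCost_eq_zero (hC1 : S.IsC1) (hstrict : S.HasStrictlyConcave)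
    {x : Config (Fin N) d} (hx : IsMinOn (S.cost να νβ) Set.univ x) :
    ∑ i, gradient (S.localCost να νβ i) x = 0 := by
  have h : fderiv ℝ (S.cost να νβ) x = 0 := (hx.isLocalMin univ_mem).fderiv_eq_zero
  have hs : fderiv ℝ (S.cost να νβ) x = ∑ i, fderiv ℝ (S.localCost να νβ i) x := by
    refine fderiv_fun_sum fun i _ => ?_
    exact (hC1.contDiff_localCost hstrict i).differentiable (by simp) x
  simp only [gradient]
  rw [← map_sum, ← hs, h, map_zero]

/-- A point at which the cost has no ascent towards a minimizer is a minimizer. -/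
theorem isMinOn_cost_of_inner_nonpos (hC1 : S.IsC1) (hconc : S.IsConcave)
    (hstrict : S.HasStrictlyConcave) (hνα : 0 < να) (hνβ : 0 < νβ) {x c : Config (Fin N) d}
    (hx : IsMinOn (S.cost να νβ) Set.univ x)
    (hc : ∑ i, inner ℝ (c - x) (gradient (S.localCost να νβ i) c) ≤ 0) :
    IsMinOn (S.cost να νβ) Set.univ c := by
  have hle : S.cost να νβ c ≤ S.cost να νβ x := by
    have : S.cost να νβ c - ∑ i, inner ℝ (c - x) (gradient (S.localCost να νβ i) c)
        ≤ S.cost να νβ x := by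
      rw [cost, cost, ← Finset.sum_sub_distrib]
      refine Finset.sum_le_sum fun i _ => ?_
      have := (convexOn_localCost hconc hstrict hνα hνβ i).add_inner_gradient_le
        ((hC1.contDiff_localCost hstrict i).differentiable (by simp) c) x
      rw [← neg_sub c x, inner_neg_right, real_inner_comm] at this
      linarith
    linarith
  exact fun y hy => hle.trans (hx hy)

end ConstraintSystem

/-! ### Flows on graphs and primal-dual dynamics -/

section PrimalDual

open Set
open scoped InnerProductSpace

variable {ι X : Type*} [Fintype ι] {G : SimpleGraph ι} [DecidableRel G.Adj]

/-- The net outflow at the vertices of a graph of a flow along its directed edges. -/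
def SimpleGraph.netOutflow [AddCommGroup X] (G : SimpleGraph ι) [DecidableRel G.Adj] :
    (ι × ι → X) →+ (ι → X) where
  toFun μ i := ∑ j ∈ G.neighborFinset i, (μ (i, j) - μ (j, i))
  map_zero' := by ext; simp
  map_add' μ ν := by
    ext i
    simp only [Pi.add_apply, ← Finset.sum_add_distrib]
    exact Finset.sum_congr rfl fun _ _ => by abel

theorem SimpleGraph.netOutflow_apply [AddCommGroup X] (μ : ι × ι → X) (i : ι) :
    G.netOutflow μ i = ∑ j ∈ G.neighborFinset i, (μ (i, j) - μ (j, i)) := rfl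

theorem SimpleGraph.sum_neighborFinset_eq [AddCommMonoid X] (f : ι → X) (i : ι) :
    ∑ j ∈ G.neighborFinset i, f j = ∑ j, if G.Adj i j then f j else 0 := by
  rw [G.neighborFinset_eq_filter, Finset.sum_filter]

theorem SimpleGraph.single_sub_single_mem_range_netOutflow [DecidableEq ι] [AddCommGroup X]
    {i j : ι} (hij : G.Adj i j) (v : X) :
    Pi.single i v - Pi.single j v ∈ (G.netOutflow (X := X)).range := by
  refine ⟨Pi.single (i, j) v, ?_⟩
  ext k
  rw [netOutflow_apply, Finset.sum_sub_distrib, Pi.sub_apply]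
  congr 1
  · by_cases hk : k = i
    · subst hk
      rw [Finset.sum_eq_single j] <;> simp +contextual [hij]
    · rw [Pi.single_eq_of_ne hk]
      exact Finset.sum_eq_zero fun l _ => Pi.single_eq_of_ne (by simp [hk]) _
  · by_cases hk : k = j
    · subst hk
      rw [Finset.sum_eq_single i] <;> simp +contextual [hij.symm]
    · rw [Pi.single_eq_of_ne hk]
      exact Finset.sum_eq_zero fun l _ => Pi.single_eq_of_ne (by simp [hk]) _

/-- On a connected graph every function with sum zero is the net outflow of some flow. -/
theorem SimpleGraph.Connected.exists_netOutflow_eq [AddCommGroup X] (hG : G.Connected) (b : ι → X)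
    (hb : ∑ i, b i = 0) : ∃ μ : ι × ι → X, G.netOutflow μ = b := by
  classical
  have hreach : ∀ i j, G.Reachable i j → ∀ v : X,
      Pi.single i v - Pi.single j v ∈ (G.netOutflow (X := X)).range := by
    intro i j hij v
    obtain ⟨w⟩ := hij
    induction w with
    | nil => simp
    | cons hadj _ ih =>
      simpa using add_mem (single_sub_single_mem_range_netOutflow hadj v) ih
  obtain ⟨i₀⟩ := hG.nonempty
  -- Each `b i` is shipped from `i` to the root `i₀`, along a path by `hreach`; the total arriving
  -- at `i₀` is zero.
  have hsum : ∑ i, (Pi.single i (b i) - Pi.single i₀ (b i) : ι → X) = b := by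
    rw [Finset.sum_sub_distrib, Finset.univ_sum_single]
    have : ∑ i, (Pi.single i₀ (b i) : ι → X) = Pi.single i₀ (∑ i, b i) :=
      (map_sum (AddMonoidHom.single (fun _ : ι => X) i₀) b Finset.univ).symm
    rw [this, hb, Pi.single_zero, sub_zero]
  have := sum_mem (S := (G.netOutflow (X := X)).range) (t := Finset.univ)
    fun i _ => hreach i i₀ (hG.preconnected i i₀) (b i)
  rwa [hsum] at this

variable [NormedAddCommGroup X] [InnerProductSpace ℝ X]

/-- Summation by parts: net outflow is adjoint to the difference along edges. This makes the
primal-dual coupling skew. -/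
theorem SimpleGraph.sum_inner_netOutflow (p : ι → X) (μ : ι × ι → X) :
    ∑ i, ⟪p i, G.netOutflow μ i⟫_ℝ
      = ∑ e : ι × ι, ⟪if G.Adj e.1 e.2 then p e.1 - p e.2 else 0, μ e⟫_ℝ := by
  have h1 : ∀ i, ⟪p i, G.netOutflow μ i⟫_ℝ
      = ∑ j, (if G.Adj i j then ⟪p i, μ (i, j)⟫_ℝ else 0)
        - ∑ j, (if G.Adj i j then ⟪p i, μ (j, i)⟫_ℝ else 0) := fun i => by
    rw [netOutflow_apply, inner_sum, sum_neighborFinset_eq, ← Finset.sum_sub_distrib]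
    refine Finset.sum_congr rfl fun j _ => ?_
    split_ifs <;> simp [inner_sub_right]
  rw [Finset.sum_congr rfl fun i _ => h1 i, Finset.sum_sub_distrib, Fintype.sum_prod_type,
    Finset.sum_comm (f := fun i j => if G.Adj i j then ⟪p i, μ (j, i)⟫_ℝ else 0),
    ← Finset.sum_sub_distrib]
  refine Finset.sum_congr rfl fun i _ => ?_
  rw [← Finset.sum_sub_distrib]
  refine Finset.sum_congr rfl fun j _ => ?_
  simp only [G.adj_comm j i]
  split_ifs <;> simp [inner_sub_left]

/-- The previous identity for the flow `p i - p j`, whose outflow is twice the graph Laplacian; each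
edge occurs in both directions, hence `1 / 2`. -/
theorem SimpleGraph.sum_inner_sum_neighborFinset_sub (p : ι → X) :
    ∑ i, ⟪p i, ∑ j ∈ G.neighborFinset i, (p i - p j)⟫_ℝ
      = 1 / 2 * ∑ e : ι × ι, if G.Adj e.1 e.2 then ‖p e.1 - p e.2‖ ^ 2 else 0 := by
  have h := sum_inner_netOutflow (G := G) p (fun e => p e.1 - p e.2)
  have h2 : ∀ i, G.netOutflow (fun e => p e.1 - p e.2) i
      = (2 : ℝ) • ∑ j ∈ G.neighborFinset i, (p i - p j) := fun i => by
    rw [netOutflow_apply, Finset.smul_sum]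
    exact Finset.sum_congr rfl fun j _ => by rw [two_smul]; abel
  simp only [h2, inner_smul_right, ← Finset.mul_sum] at h
  have h3 : ∀ e : ι × ι, ⟪if G.Adj e.1 e.2 then p e.1 - p e.2 else 0, p e.1 - p e.2⟫_ℝ
      = if G.Adj e.1 e.2 then ‖p e.1 - p e.2‖ ^ 2 else 0 := fun e => by
    split_ifs
    · exact real_inner_self_eq_norm_sq _
    · exact inner_zero_left _
  rw [Finset.sum_congr rfl fun e _ => h3 e] at h
  linarith

/-- The primal-dual vector field on node and edge variables whose node variables follow `-Φ`, a
consensus term of gain `k` and the net outflow of the edge variables, these in turn integrating the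
disagreement along the edges, with gain `c`. -/
def primalDualField (G : SimpleGraph ι) [DecidableRel G.Adj] (Φ : ι → X → X) (k c : ℝ)
    (y : PiLp 2 fun _ : ι ⊕ ι × ι => X) : PiLp 2 fun _ : ι ⊕ ι × ι => X :=
  WithLp.toLp 2 (Sum.elim
    (fun i => -Φ i (y (.inl i)) - k • (∑ j ∈ G.neighborFinset i, (y (.inl i) - y (.inl j)))
      - c • G.netOutflow (fun e => y (.inr e)) i)
    (fun e => c • if G.Adj e.1 e.2 then y (.inl e.1) - y (.inl e.2) else 0))

variable {Φ : ι → X → X} {k c : ℝ}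

theorem continuous_primalDualField (hΦ : ∀ i, Continuous (Φ i)) :
    Continuous (primalDualField G Φ k c) := by
  refine (PiLp.continuous_toLp 2 _).comp (continuous_pi fun s => ?_)
  rcases s with i | e
  · have := hΦ i
    simp only [Sum.elim_inl, SimpleGraph.netOutflow_apply]
    fun_prop
  · simp only [Sum.elim_inr]
    split_ifs <;> fun_prop

/-- The terms with factor `c` cancel by adjointness, leaving the monotone operators and the
Laplacian energy. -/
theorem inner_primalDualField_sub (x y : PiLp 2 fun _ : ι ⊕ ι × ι => X) :
    ⟪x - y, primalDualField G Φ k c x - primalDualField G Φ k c y⟫_ℝ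
      = -(∑ i, ⟪x (.inl i) - y (.inl i), Φ i (x (.inl i)) - Φ i (y (.inl i))⟫_ℝ
        + k / 2 * ∑ e : ι × ι, if G.Adj e.1 e.2 then
          ‖(x (.inl e.1) - y (.inl e.1)) - (x (.inl e.2) - y (.inl e.2))‖ ^ 2 else 0) := by
  set p : ι → X := fun i => x (.inl i) - y (.inl i) with hp
  set ν : ι × ι → X := fun e => x (.inr e) - y (.inr e) with hν
  have hL : ∀ i, (∑ j ∈ G.neighborFinset i, (x (.inl i) - x (.inl j)))
      - ∑ j ∈ G.neighborFinset i, (y (.inl i) - y (.inl j))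
      = ∑ j ∈ G.neighborFinset i, (p i - p j) := fun i => by
    rw [← Finset.sum_sub_distrib]
    exact Finset.sum_congr rfl fun j _ => by simp only [hp]; abel
  have hD : ∀ i, G.netOutflow (fun e => x (.inr e)) i - G.netOutflow (fun e => y (.inr e)) i
      = G.netOutflow ν i := fun i => by
    rw [← Pi.sub_apply, ← map_sub]; rfl
  have hinl : ∀ i, (primalDualField G Φ k c x - primalDualField G Φ k c y) (.inl i)
      = -(Φ i (x (.inl i)) - Φ i (y (.inl i))) - k • (∑ j ∈ G.neighborFinset i, (p i - p j))
        - c • G.netOutflow ν i := fun i => by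
    rw [← hL, ← hD, smul_sub, smul_sub]
    simp only [primalDualField, PiLp.sub_apply, Sum.elim_inl]
    abel
  have hinr : ∀ e, (primalDualField G Φ k c x - primalDualField G Φ k c y) (.inr e)
      = c • if G.Adj e.1 e.2 then p e.1 - p e.2 else 0 := fun e => by
    simp only [primalDualField, PiLp.sub_apply, Sum.elim_inr, ← smul_sub]
    congr 1
    split_ifs
    · simp only [hp]; abel
    · simp
  rw [PiLp.inner_apply, Fintype.sum_sum_type]
  simp only [hinl, hinr]
  have e1 : ∀ i, ⟪(x - y) (.inl i), -(Φ i (x (.inl i)) - Φ i (y (.inl i)))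
        - k • (∑ j ∈ G.neighborFinset i, (p i - p j)) - c • G.netOutflow ν i⟫_ℝ
      = -⟪p i, Φ i (x (.inl i)) - Φ i (y (.inl i))⟫_ℝ
        - k * ⟪p i, ∑ j ∈ G.neighborFinset i, (p i - p j)⟫_ℝ - c * ⟪p i, G.netOutflow ν i⟫_ℝ :=
    fun i => by
      rw [inner_sub_right, inner_sub_right, inner_neg_right, inner_smul_right, inner_smul_right]
      rfl
  have e2 : ∀ e, ⟪(x - y) (.inr e), c • if G.Adj e.1 e.2 then p e.1 - p e.2 else 0⟫_ℝ
      = c * ⟪if G.Adj e.1 e.2 then p e.1 - p e.2 else 0, ν e⟫_ℝ := fun e => by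
    rw [inner_smul_right, real_inner_comm]; rfl
  rw [Finset.sum_congr rfl fun i _ => e1 i, Finset.sum_congr rfl fun e _ => e2 e,
    Finset.sum_sub_distrib, Finset.sum_sub_distrib, Finset.sum_neg_distrib, ← Finset.mul_sum,
    ← Finset.mul_sum, ← Finset.mul_sum, SimpleGraph.sum_inner_netOutflow, SimpleGraph.sum_inner_sum_neighborFinset_sub]
  ring

theorem inner_primalDualField_sub_nonpos (hk : 0 ≤ k)
    (hΦ : ∀ i x y, 0 ≤ ⟪x - y, Φ i x - Φ i y⟫_ℝ) (x y : PiLp 2 fun _ : ι ⊕ ι × ι => X) :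
    ⟪x - y, primalDualField G Φ k c x - primalDualField G Φ k c y⟫_ℝ ≤ 0 := by
  rw [inner_primalDualField_sub, neg_nonpos]
  refine add_nonneg (Finset.sum_nonneg fun i _ => hΦ i _ _)
    (mul_nonneg (by positivity) (Finset.sum_nonneg fun e _ => ?_))
  split_ifs <;> positivity

/-- The node variables of every trajectory of the primal-dual vector field tend to a common zero
`xhat` of the sum of the monotone operators, if it is unique in the given sense. -/
theorem tendsto_of_primalDual [FiniteDimensional ℝ X] (hG : G.Connected) (hk : 0 < k) (hc : c ≠ 0)
    (hcont : ∀ i, Continuous (Φ i)) (hΦ : ∀ i x y, 0 ≤ ⟪x - y, Φ i x - Φ i y⟫_ℝ) {xhat : X}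
    (hzero : ∑ i, Φ i xhat = 0) (hunique : ∀ x, ∑ i, ⟪x - xhat, Φ i x⟫_ℝ ≤ 0 → x = xhat)
    {y : ℝ → PiLp 2 fun _ : ι ⊕ ι × ι => X}
    (hy : ∀ t, 0 ≤ t → HasDerivWithinAt y (primalDualField G Φ k c (y t)) (Ici 0) t) (i : ι) :
    Tendsto (fun t => y t (.inl i)) atTop (𝓝 xhat) := by
  -- Equilibrium edge variables: their outflow cancels each `Φ i xhat`.
  obtain ⟨μ, hμ⟩ := hG.exists_netOutflow_eq (fun i => -(c⁻¹ • Φ i xhat))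
    (by rw [Finset.sum_neg_distrib, ← Finset.smul_sum, hzero, smul_zero, neg_zero])
  set yeq : PiLp 2 fun _ : ι ⊕ ι × ι => X := WithLp.toLp 2 (Sum.elim (fun _ => xhat) μ) with hyeq
  have hyl : ∀ i, yeq (.inl i) = xhat := fun _ => rfl
  have heqz : primalDualField G Φ k c yeq = 0 := by
    ext1 s
    rcases s with i | e
    · have : G.netOutflow (fun e => yeq (.inr e)) i = -(c⁻¹ • Φ i xhat) := congrFun hμ i
      simp only [primalDualField, Sum.elim_inl, this, hyl, sub_self, Finset.sum_const_zero,
        smul_zero, smul_neg, smul_inv_smul₀ hc]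
      simp
    · simp [primalDualField, hyl]
  refine tendsto_of_dissipation (continuous_primalDualField hcont)
    (q := fun y : PiLp 2 fun _ : ι ⊕ ι × ι => X => y (.inl i)) (by fun_prop) (yeq := yeq) ?_ ?_ hy
  · intro x
    simpa [heqz] using inner_primalDualField_sub_nonpos (G := G) (c := c) hk.le hΦ x yeq
  · intro x hx
    have h := inner_primalDualField_sub (G := G) (Φ := Φ) (k := k) (c := c) x yeq
    rw [heqz, sub_zero, hx] at h
    simp only [hyl] at h
    have hA : 0 ≤ ∑ i, ⟪x (.inl i) - xhat, Φ i (x (.inl i)) - Φ i xhat⟫_ℝ :=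
      Finset.sum_nonneg fun i _ => hΦ i _ _
    have hterm : ∀ e : ι × ι, 0 ≤ if G.Adj e.1 e.2 then
        ‖(x (.inl e.1) - xhat) - (x (.inl e.2) - xhat)‖ ^ 2 else 0 := fun e => by
      split_ifs <;> positivity
    have hB := Finset.sum_nonneg (s := Finset.univ) fun e _ => hterm e
    have hB0 : ∑ e : ι × ι, (if G.Adj e.1 e.2 then
        ‖(x (.inl e.1) - xhat) - (x (.inl e.2) - xhat)‖ ^ 2 else 0) = 0 := by nlinarith
    have hA0 : ∑ i, ⟪x (.inl i) - xhat, Φ i (x (.inl i)) - Φ i xhat⟫_ℝ = 0 := by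
      rw [hB0] at h; linarith
    have hadj : ∀ i j, G.Adj i j → x (.inl i) = x (.inl j) := fun i j hij => by
      have := (Finset.sum_eq_zero_iff_of_nonneg fun e _ => hterm e).1 hB0 (i, j)
        (Finset.mem_univ _)
      simpa [hij, sub_eq_zero] using this
    have hconst : ∀ j, x (.inl j) = x (.inl i) := fun j => by
      obtain ⟨w⟩ := hG.preconnected j i
      induction w with
      | nil => rfl
      | cons hab _ ih => exact (hadj _ _ hab).trans ih
    refine hunique _ ?_
    -- At consensus the `Φ i xhat` terms pair with one common vector, and their sum is zero.
    simp only [hconst, inner_sub_right, Finset.sum_sub_distrib] at hA0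
    rw [← inner_sum (f := fun i => Φ i xhat), hzero, inner_zero_right, sub_zero] at hA0
    exact hA0.le

end PrimalDual

/-! ### Lifting integral states to edge variables -/

section PrimalDualLift

open Set

variable {ι X : Type*} [Fintype ι] {G : SimpleGraph ι} [DecidableRel G.Adj]
  [NormedAddCommGroup X] [InnerProductSpace ℝ X] {Φ : ι → X → X} {k c : ℝ}

theorem hasDerivWithinAt_piLp {κ : Type*} [Fintype κ] {y : ℝ → PiLp 2 fun _ : κ => X}
    {y' : PiLp 2 fun _ : κ => X} {s : Set ℝ} {t : ℝ} :
    HasDerivWithinAt y y' s t ↔ ∀ i, HasDerivWithinAt (fun r => y r i) (y' i) s t := by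
  simp only [hasDerivWithinAt_iff_hasFDerivWithinAt]
  rw [hasFDerivWithinAt_piLp]
  refine forall_congr' fun i => ?_
  have : PiLp.proj 2 (fun _ : κ => X) i ∘L ContinuousLinearMap.toSpanSingleton ℝ y'
      = ContinuousLinearMap.toSpanSingleton ℝ (y' i) := by
    ext; simp
  rw [← this]

theorem eq_of_hasDerivWithinAt_Ici_eq {f g f' : ℝ → X} (h0 : f 0 = g 0)
    (hf : ∀ t, 0 ≤ t → HasDerivWithinAt f (f' t) (Ici 0) t)
    (hg : ∀ t, 0 ≤ t → HasDerivWithinAt g (f' t) (Ici 0) t) {t : ℝ} (ht : 0 ≤ t) : f t = g t := by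
  have := norm_image_sub_le_of_norm_deriv_le_segment' (a := 0) (b := t) (C := 0)
    (f := fun s => f s - g s) (f' := fun s => f' s - f' s)
    (fun s hs => ((hf s hs.1).sub (hg s hs.1)).mono fun r hr => hr.1)
    (fun s _ => by simp) t ⟨ht, le_rfl⟩
  simpa [h0, sub_eq_zero] using this

/-- The flow is antisymmetric, so each edge counts twice, and the gain enters twice: hence `2 * c ^
2`. -/
theorem SimpleGraph.netOutflow_smul_ite (c : ℝ) (p : ι → X) (i : ι) :
    c • G.netOutflow (fun e => c • if G.Adj e.1 e.2 then p e.1 - p e.2 else 0) i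
      = (2 * c ^ 2) • ∑ j ∈ G.neighborFinset i, (p i - p j) := by
  rw [netOutflow_apply, Finset.smul_sum, Finset.smul_sum]
  refine Finset.sum_congr rfl fun j hj => ?_
  have hadj : G.Adj i j := (G.mem_neighborFinset i j).1 hj
  simp only [hadj, hadj.symm, if_true]
  module

theorem HasDerivWithinAt.netOutflow {μ : ℝ → ι × ι → X} {μ' : ι × ι → X} {s : Set ℝ} {t : ℝ}
    (hμ : ∀ e, HasDerivWithinAt (fun r => μ r e) (μ' e) s t) (i : ι) :
    HasDerivWithinAt (fun r => G.netOutflow (μ r) i) (G.netOutflow μ' i) s t := by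
  simp only [SimpleGraph.netOutflow_apply]
  exact HasDerivWithinAt.fun_sum fun j _ => (hμ _).sub (hμ _)

/-- Proportional-integral consensus dynamics whose integral states start at zero are the node part
of primal-dual dynamics. -/
theorem exists_primalDual_lift [CompleteSpace X] {e z : ℝ → ι → X}
    (he : ∀ t, 0 ≤ t → ∀ i, HasDerivWithinAt (fun s => e s i)
      (-Φ i (e t i) - k • (∑ j ∈ G.neighborFinset i, (e t i - e t j)) - z t i) (Ici 0) t)
    (hz : ∀ t, 0 ≤ t → ∀ i, HasDerivWithinAt (fun s => z s i)
      ((2 * c ^ 2) • ∑ j ∈ G.neighborFinset i, (e t i - e t j)) (Ici 0) t)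
    (hz0 : ∀ i, z 0 i = 0) :
    ∃ y : ℝ → PiLp 2 fun _ : ι ⊕ ι × ι => X,
      (∀ t i, y t (.inl i) = e t i) ∧
      ∀ t, 0 ≤ t → HasDerivWithinAt y (primalDualField G Φ k c (y t)) (Ici 0) t := by
  have hec : ∀ i, Continuous fun s => e (max s 0) i := fun i =>
    ContinuousOn.comp_continuous (s := Ici 0) (f := fun s : ℝ => max s 0)
      (fun t ht => (he t ht i).continuousWithinAt) (by fun_prop)
      fun s => mem_Ici.2 (le_max_right s 0)
  let r : ℝ → ι × ι → X := fun s a =>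
    c • if G.Adj a.1 a.2 then e (max s 0) a.1 - e (max s 0) a.2 else 0
  have hrc : ∀ a, Continuous fun s => r s a := fun a => by
    refine Continuous.const_smul ?_ c
    split_ifs
    · exact (hec _).sub (hec _)
    · exact continuous_const
  let μ : ℝ → ι × ι → X := fun t a => ∫ s in (0 : ℝ)..t, r s a
  have hμ : ∀ t a, HasDerivWithinAt (fun s => μ s a) (r t a) (Ici 0) t := fun t a =>
    ((hrc a).integral_hasStrictDerivAt 0 t).hasDerivAt.hasDerivWithinAt
  -- Both sides have the same derivative and, as `z` starts at zero, the same initial value.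
  have hzμ : ∀ t, 0 ≤ t → ∀ i, z t i = c • G.netOutflow (μ t) i := by
    intro t ht i
    have hμ0 : μ 0 = 0 := by ext a; simp [μ]
    refine eq_of_hasDerivWithinAt_Ici_eq (f := fun t => z t i)
      (g := fun t => c • G.netOutflow (μ t) i) (by simp [hz0, hμ0]) (fun s hs => hz s hs i)
      (fun s hs => ?_) ht
    rw [← SimpleGraph.netOutflow_smul_ite c (fun i => e s i) i]
    have := (HasDerivWithinAt.netOutflow (G := G) (fun a => hμ s a) i).const_smul c
    simp only [r, max_eq_left hs] at this
    exact this
  refine ⟨fun t => WithLp.toLp 2 (Sum.elim (e t) (μ t)), fun t i => rfl, fun t ht => ?_⟩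
  refine hasDerivWithinAt_piLp.2 fun s => ?_
  rcases s with i | a
  · have := he t ht i
    rw [hzμ t ht i] at this
    exact this
  · have := hμ t a
    simp only [r, max_eq_left ht] at this
    exact this

end PrimalDualLift

/-! ### The closed loop: existence and convergence -/

namespace ConstraintSystem

variable {N d : ℕ} {S : ConstraintSystem N d} {να νβ k₁ k₂ : ℝ} {G : SimpleGraph (Fin N)}
  [DecidableRel G.Adj]

theorem hasDerivWithinAt_block {x : ℝ → Config (Fin N) d} {x' : Config (Fin N) d} {s : Set ℝ}
    {t : ℝ} (hx : HasDerivWithinAt x x' s t) (i : Fin N) :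
    HasDerivWithinAt (fun r => Config.block (x r) i) (Config.block x' i) s t :=
  hasDerivWithinAt_piLp.2 fun c => hasDerivWithinAt_piLp.1 hx (i, c)

theorem inner_smul_gradient_localCost_sub_nonneg (hC1 : S.IsC1) (hconc : S.IsConcave)
    (hstrict : S.HasStrictlyConcave) (hνα : 0 < να) (hνβ : 0 < νβ) (hk₁ : 0 < k₁) (i : Fin N)
    (x y : Config (Fin N) d) :
    0 ≤ inner ℝ (x - y) (k₁ • gradient (S.localCost να νβ i) x
      - k₁ • gradient (S.localCost να νβ i) y) := by
  rw [← smul_sub, inner_smul_right]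
  exact mul_nonneg hk₁.le ((convexOn_localCost hconc hstrict hνα hνβ
    i).inner_gradient_sub_gradient_nonneg
      ((hC1.contDiff_localCost hstrict i).differentiable (by simp)) x y)

theorem exists_isClosedLoop (hC1 : S.IsC1) (hconc : S.IsConcave) (hstrict : S.HasStrictlyConcave)
    (hνα : 0 < να) (hνβ : 0 < νβ) (hk₁ : 0 < k₁) (hk₂ : 0 < k₂) (x₀ : Config (Fin N) d)
    (e₀ : Fin N → Config (Fin N) d) (h₀ : ∀ i, Config.block (e₀ i) i = Config.block x₀ i) :
    ∃ x e z, S.IsClosedLoop G να νβ k₁ k₂ x e z ∧ x 0 = x₀ ∧ e 0 = e₀ := by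
  set c := √(k₁ * k₂ / 2) with hc
  have hc2 : 2 * c ^ 2 = k₁ * k₂ := by rw [hc, Real.sq_sqrt (by positivity)]; ring
  let Φ : Fin N → Config (Fin N) d → Config (Fin N) d := fun i x =>
    k₁ • gradient (S.localCost να νβ i) x
  have hcont : ∀ i, Continuous (Φ i) := fun i =>
    (hC1.contDiff_localCost hstrict i).continuous_gradient.const_smul k₁
  have hmono : ∀ i x y, 0 ≤ inner ℝ (x - y) (Φ i x - Φ i y) :=
    inner_smul_gradient_localCost_sub_nonneg hC1 hconc hstrict hνα hνβ hk₁
  -- Zero initial edge variables give zero initial integral states.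
  obtain ⟨y, hy0, hy⟩ := exists_solution_of_dissipative
    (continuous_primalDualField (G := G) (k := k₂) (c := c) hcont)
    (inner_primalDualField_sub_nonpos hk₂.le hmono) (WithLp.toLp 2 (Sum.elim e₀ 0))
  have he : ∀ t, 0 ≤ t → ∀ i, HasDerivWithinAt (fun s => y s (.inl i))
      (S.estimateRate G να νβ k₁ k₂ (fun i => y t (.inl i))
        (fun i => c • G.netOutflow (fun a => y t (.inr a)) i) i) (Set.Ici 0) t :=
    fun t ht i => hasDerivWithinAt_piLp.1 (hy t ht) (.inl i)
  -- Each agent's position is read off its own block of its own estimate.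
  refine ⟨fun t => WithLp.toLp 2 fun p => y t (.inl p.1) p, fun t i => y t (.inl i),
    fun t i => c • G.netOutflow (fun a => y t (.inr a)) i, ⟨he, ?_, ?_, ?_, ?_⟩, ?_, ?_⟩
  · intro t ht i
    have := (HasDerivWithinAt.netOutflow (G := G)
      (fun a => hasDerivWithinAt_piLp.1 (hy t ht) (.inr a)) i).const_smul c
    rw [← hc2, ← SimpleGraph.netOutflow_smul_ite c (fun i => y t (.inl i)) i]
    exact this
  · intro t ht i
    have := hasDerivWithinAt_block (he t ht i) i
    rw [(he t ht i).derivWithin (uniqueDiffOn_Ici 0 t ht)]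
    exact this
  · intro i
    rfl
  · intro i
    have : (fun a => y 0 (.inr a)) = (0 : Fin N × Fin N → Config (Fin N) d) := by
      rw [hy0]; rfl
    simp [this]
  · ext p
    have := congrArg (fun v => v p.2) (h₀ p.1)
    simp only [hy0]
    exact this
  · simp only [hy0]
    rfl

theorem IsClosedLoop.block_eq {x : ℝ → Config (Fin N) d} {e z : ℝ → Fin N → Config (Fin N) d}
    (h : S.IsClosedLoop G να νβ k₁ k₂ x e z) {t : ℝ} (ht : 0 ≤ t) (i : Fin N) :
    Config.block (x t) i = Config.block (e t i) i := by
  refine eq_of_hasDerivWithinAt_Ici_eq (f := fun t => Config.block (x t) i)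
    (g := fun t => Config.block (e t i) i) (h.init_estimate i).symm
    (fun s hs => h.position s hs i) (fun s hs => ?_) ht
  have := h.estimate s hs i
  rw [this.derivWithin (uniqueDiffOn_Ici 0 s hs)]
  exact hasDerivWithinAt_block this i

theorem IsClosedLoop.tendsto {x : ℝ → Config (Fin N) d} {e z : ℝ → Fin N → Config (Fin N) d}
    (h : S.IsClosedLoop G να νβ k₁ k₂ x e z) (hG : G.Connected) (hC1 : S.IsC1)
    (hconc : S.IsConcave) (hstrict : S.HasStrictlyConcave) (hνα : 0 < να) (hνβ : 0 < νβ)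
    (hk₁ : 0 < k₁) (hk₂ : 0 < k₂) {xhat : Config (Fin N) d}
    (hxhat : {x | IsMinOn (S.cost να νβ) Set.univ x} = {xhat}) :
    Tendsto x atTop (𝓝 xhat) := by
  set c := √(k₁ * k₂ / 2) with hc
  have hc2 : 2 * c ^ 2 = k₁ * k₂ := by rw [hc, Real.sq_sqrt (by positivity)]; ring
  have hmin : IsMinOn (S.cost να νβ) Set.univ xhat := by
    have : xhat ∈ {x | IsMinOn (S.cost να νβ) Set.univ x} := by rw [hxhat]; rfl
    exact this
  obtain ⟨y, hye, hy⟩ := exists_primalDual_lift (G := G) (k := k₂) (c := c)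
    (Φ := fun i x => k₁ • gradient (S.localCost να νβ i) x) (e := e) (z := z)
    h.estimate (by rw [hc2]; exact h.integral) h.init_integral
  have hconv : ∀ i, Tendsto (fun t => e t i) atTop (𝓝 xhat) := fun i => by
    simp only [← hye]
    refine tendsto_of_primalDual (Φ := fun i x => k₁ • gradient (S.localCost να νβ i) x) hG hk₂
      (by positivity)
      (fun i => (hC1.contDiff_localCost hstrict i).continuous_gradient.const_smul k₁)
      (inner_smul_gradient_localCost_sub_nonneg hC1 hconc hstrict hνα hνβ hk₁)
      ?_ (fun x hx => ?_) hy i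
    · rw [← Finset.smul_sum, sum_gradient_localCost_eq_zero hC1 hstrict hmin, smul_zero]
    · simp only [inner_smul_right, ← Finset.mul_sum] at hx
      have : x ∈ {x | IsMinOn (S.cost να νβ) Set.univ x} :=
        isMinOn_cost_of_inner_nonpos hC1 hconc hstrict hνα hνβ hmin
          (nonpos_of_mul_nonpos_right hx hk₁)
      rwa [hxhat] at this
  have hcoord : ∀ p, Tendsto (fun t => x t p) atTop (𝓝 (xhat p)) := fun p => by
    refine (((EuclideanSpace.proj p).continuous.tendsto xhat).comp (hconv p.1)).congr' ?_
    filter_upwards [eventually_ge_atTop 0] with t ht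
    exact (congrArg (fun v => v p.2) (h.block_eq ht p.1)).symm
  exact ((PiLp.continuous_toLp 2 _).tendsto _).comp (tendsto_pi_nhds.2 hcoord)

end ConstraintSystem

/-! ### The main theorem -/

theorem theorem1 {N d : ℕ} (S : ConstraintSystem N d) (hC1 : S.IsC1)
    (G : SimpleGraph (Fin N)) [DecidableRel G.Adj]
    (hcomm : S.CommConnectedOnClusters G) (hone : S.HasOneCluster)
    (hcoer : S.Coercive) (hconc : S.IsConcave) (hstrict : S.HasStrictlyConcave)
    (να νβ k₁ k₂ : ℝ) (hνα : 0 < να) (hνβ : 0 < νβ) (hk₁ : 0 < k₁) (hk₂ : 0 < k₂) :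
    ∃ xhat : Config (Fin N) d,
      {x | IsMinOn (S.cost να νβ) Set.univ x} = {xhat} ∧
      {x | IsMaxOn (S.β να νβ) Set.univ x} = {xhat} ∧
      (∀ (x₀ : Config (Fin N) d) (e₀ : Fin N → Config (Fin N) d),
        (∀ i, Config.block (e₀ i) i = Config.block x₀ i) →
        ∃ x e z, S.IsClosedLoop G να νβ k₁ k₂ x e z ∧ x 0 = x₀ ∧ e 0 = e₀) ∧
      ∀ x e z, S.IsClosedLoop G να νβ k₁ k₂ x e z → Tendsto x atTop (𝓝 xhat) := by
  have hG : G.Connected := (SimpleGraph.induceUnivIso G).connected_iff.1 (hcomm _ hone)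
  obtain ⟨i, -⟩ := hone.nonempty
  have : NeZero N := ⟨by rintro rfl; exact i.elim0⟩
  obtain ⟨xhat, hxhat⟩ :=
    ConstraintSystem.exists_minimizers_cost_eq_singleton hC1 hcoer hconc hstrict hνα hνβ
  refine ⟨xhat, hxhat, ?_, fun x₀ e₀ h₀ => ?_, fun x e z h => ?_⟩
  · simp only [ConstraintSystem.isMaxOn_β_iff hstrict hνβ, hxhat]
  · exact ConstraintSystem.exists_isClosedLoop hC1 hconc hstrict hνα hνβ hk₁ hk₂ x₀ e₀ h₀
  · exact h.tendsto hG hC1 hconc hstrict hνα hνβ hk₁ hk₂ hxhat
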